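/- Let $G$ be an infinite, connected, locally finite simple graph that is chordal, i.e. has no induced cycle of length greater than $3$. A clique of $G$ is a vertex set that is maximal among the sets of pairwise adjacent vertices; the clique graph of $G$ has the cliques of $G$ as its vertices, with an edge between any two distinct cliques that intersect. A clique tree of $G$ is a spanning tree $T$ of the clique graph such that, for every vertex $v$ of $G$, the subgraph of $T$ induced by the set of cliques containing $v$ is a tree. Then the set of clique trees of $G$ is either finite or uncountable; in the latter case its cardinality is exactly that of the continuum, $2^{\aleph_0}$. -/

import Mathlib

namespace CliqueTree

variable {V : Type*}

/-- A graph is chordal if it has no induced cycle of length greater than three.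
Connectedness is a separate hypothesis. -/
def IsChordal (G : SimpleGraph V) : Prop :=
  ∀ n : ℕ, 3 < n → IsEmpty (SimpleGraph.cycleGraph n ↪g G)

/-- The cliques of `G`, that is, the vertex sets that are maximal among the complete ones.
(Mathlib's `IsClique` only says that a set is complete.) -/
abbrev Cliques (G : SimpleGraph V) : Type _ := {K : Set V // Maximal G.IsClique K}

/-- The clique graph: distinct cliques are adjacent if they intersect. -/
def cliqueGraph (G : SimpleGraph V) : SimpleGraph (Cliques G) where
  Adj K L := K ≠ L ∧ (K.1 ∩ L.1).Nonempty
  symm := ⟨fun _ _ h => ⟨h.1.symm, by rw [Set.inter_comm]; exact h.2⟩⟩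
  loopless := ⟨fun _ h => h.1 rfl⟩

/-- The clique family generated by a vertex: the cliques that contain it. -/
def family (G : SimpleGraph V) (v : V) : Set (Cliques G) := {K | v ∈ K.1}

/-- The set of clique trees of `G`: the spanning trees `T` of the clique graph such that every
family of cliques through a given vertex induces a subtree of `T`. A spanning subgraph is given
by its adjacency relation on all cliques; trees are connected and acyclic, hence non-empty. -/
def cliqueTrees (G : SimpleGraph V) : Set (SimpleGraph (Cliques G)) :=
  {T | T ≤ cliqueGraph G ∧ T.IsTree ∧ ∀ v : V, (T.induce (family G v)).IsTree}

end CliqueTree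

/-! Identify a clique tree with the indicator of its edge set, a point of the Cantor space of
`Bool`-valued functions on the countable set of pairs of cliques. The clique trees form a closed set
there (`isClosed_image_edgeCode`). Swapping tree edges with equal separators makes it perfect once
it is infinite (`exists_ne_agree_on_finset`), and a nonempty perfect set has continuum many points.
-/

namespace CliqueTree

section Graph

open SimpleGraph

variable {C : Type*}

/-- Exchanging the edge `s(a, b)` of a connected graph for an edge joining two vertices that
become separated when `s(a, b)` is deleted keeps the graph connected. -/
theorem preconnected_of_exchange {H H' : SimpleGraph C} {a b c d : C} (hH : H.Preconnected)
    (hle : H.deleteEdges {s(a, b)} ≤ H') (hcd : H'.Adj c d)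
    (hsep : ¬ (H.deleteEdges {s(a, b)}).Reachable c d) : H'.Preconnected := by
  have key : ∀ x : C, (H.deleteEdges {s(a, b)}).Reachable x a ∨
      (H.deleteEdges {s(a, b)}).Reachable x b := by
    intro x
    obtain ⟨p⟩ := hH x a
    induction p with
    | nil => exact Or.inl (Reachable.refl _)
    | @cons u v w h p ih =>
      by_cases he : s(u, v) = s(w, b)
      · rcases Sym2.eq_iff.1 he with ⟨rfl, -⟩ | ⟨rfl, -⟩
        · exact Or.inl (Reachable.refl _)
        · exact Or.inr (Reachable.refl _)
      · have huv : (H.deleteEdges {s(w, b)}).Adj u v := by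
          rw [deleteEdges_adj]; exact ⟨h, he⟩
        exact (ih hle hsep).imp huv.reachable.trans huv.reachable.trans
  have hab : H'.Reachable a b := by
    rcases key c with hc | hc <;> rcases key d with hd | hd
    · exact absurd (hc.trans hd.symm) hsep
    · exact (hc.mono hle).symm.trans (hcd.reachable.trans (hd.mono hle))
    · exact (hd.mono hle).symm.trans (hcd.reachable.symm.trans (hc.mono hle))
    · exact absurd (hc.trans hd.symm) hsep
  have hx : ∀ x, H'.Reachable x a := fun x =>
    (key x).elim (fun h => h.mono hle) fun h => (h.mono hle).trans hab.symm
  exact fun x y => (hx x).trans (hx y).symm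

/-- If deleting `s(a, b)` separates two vertices of a set that induces a connected graph, then
the set contains `a` and `b`. -/
theorem mem_of_not_reachable_deleteEdges {T : SimpleGraph C} {s : Set C} {a b c d : C}
    (hs : (T.induce s).Preconnected) (hc : c ∈ s) (hd : d ∈ s)
    (hsep : ¬ (T.deleteEdges {s(a, b)}).Reachable c d) : a ∈ s ∧ b ∈ s := by
  by_contra hab
  refine hsep ?_
  let φ : T.induce s →g T.deleteEdges {s(a, b)} :=
    { toFun := Subtype.val
      map_rel' := by
        rintro ⟨x, hx⟩ ⟨y, hy⟩ h
        rw [deleteEdges_adj]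
        refine ⟨h, fun he => hab ?_⟩
        rcases Sym2.eq_iff.1 he with ⟨rfl, rfl⟩ | ⟨rfl, rfl⟩
        · exact ⟨hx, hy⟩
        · exact ⟨hy, hx⟩ }
  exact (hs ⟨c, hc⟩ ⟨d, hd⟩).map φ

/-- In a forest, a set that induces a connected graph contains every path between its members. -/
theorem support_subset_of_induce_preconnected {T : SimpleGraph C} (hT : T.IsAcyclic) {s : Set C}
    (hs : (T.induce s).Preconnected) {a b : C} (ha : a ∈ s) (hb : b ∈ s) (p : T.Path a b) :
    ∀ x ∈ p.1.support, x ∈ s := by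
  obtain ⟨q, hq⟩ := (hs ⟨a, ha⟩ ⟨b, hb⟩).exists_isPath
  have hinj : Function.Injective (Embedding.induce (G := T) s).toHom := Subtype.val_injective
  have h := (hT.subsingleton_path a b).elim p ⟨q.map (Embedding.induce (G := T) s).toHom,
    hq.map hinj⟩
  subst h
  intro x hx
  obtain ⟨y, -, rfl⟩ := List.mem_map.1 ((Walk.support_map _ q) ▸ hx)
  exact y.2

/-- A connected locally finite graph has countably many vertices. -/
theorem countable_of_connected_locallyFinite {V : Type*} (G : SimpleGraph V) [G.LocallyFinite]
    (hG : G.Connected) : Countable V := by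
  have hfin : ∀ (n : ℕ) (v : V), {w | ∃ p : G.Walk v w, p.length = n}.Finite := by
    intro n
    induction n with
    | zero =>
      intro v
      refine (Set.finite_singleton v).subset ?_
      rintro w ⟨p, hp⟩
      exact (Walk.eq_of_length_eq_zero hp).symm
    | succ n ih =>
      intro v
      refine ((Set.toFinite (G.neighborSet v)).biUnion fun u _ => ih u).subset ?_
      rintro w ⟨p, hp⟩
      cases p with
      | nil => simp at hp
      | cons h q => exact Set.mem_biUnion h ⟨q, by simpa using hp⟩
  obtain ⟨v⟩ := hG.nonempty
  refine Set.countable_univ_iff.1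
    ((Set.countable_iUnion fun n => (hfin n v).countable).mono fun w _ => ?_)
  obtain ⟨p⟩ := hG.preconnected v w
  exact Set.mem_iUnion.2 ⟨p.length, p, rfl⟩

end Graph

variable {V : Type*} {G : SimpleGraph V}

/-! ### Finiteness of families and separators -/

section Cliques

theorem clique_nonempty [Nonempty V] (K : Cliques G) : K.1.Nonempty := by
  by_contra h
  rw [Set.not_nonempty_iff_eq_empty] at h
  obtain ⟨v⟩ := ‹Nonempty V›
  have : ({v} : Set V) ⊆ K.1 :=
    K.2.2 (y := {v}) (by simp) (by rw [h]; exact Set.empty_subset _)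
  rw [h] at this
  exact this rfl

theorem family_finite [G.LocallyFinite] (v : V) : (family G v).Finite := by
  have hN : (insert v (G.neighborSet v)).Finite := (Set.toFinite _).insert v
  refine Set.Finite.of_finite_image (hN.finite_subsets.subset ?_) Subtype.val_injective.injOn
  rintro _ ⟨K, hK, rfl⟩ w hw
  by_cases h : w = v
  · exact Or.inl h
  · exact Or.inr (K.2.1 hK hw (Ne.symm h))

theorem countable_cliques [G.LocallyFinite] (hG : G.Connected) : Countable (Cliques G) := by
  have := countable_of_connected_locallyFinite G hG
  have := hG.nonempty
  refine Set.countable_univ_iff.1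
    ((Set.countable_iUnion fun v => (family_finite (G := G) v).countable).mono fun K _ => ?_)
  obtain ⟨v, hv⟩ := clique_nonempty K
  exact Set.mem_iUnion.2 ⟨v, hv⟩

/-- The intersection of the two ends of an edge of the clique graph. -/
def separator (e : Sym2 (Cliques G)) : Set V :=
  Sym2.lift ⟨fun K L => K.1 ∩ L.1, fun K L => Set.inter_comm K.1 L.1⟩ e

@[simp] theorem separator_mk (K L : Cliques G) : separator s(K, L) = K.1 ∩ L.1 := rfl

theorem finite_separator_eq [G.LocallyFinite] (e : Sym2 (Cliques G)) :
    {f | f ∈ (cliqueGraph G).edgeSet ∧ separator f = separator e}.Finite := by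
  rcases (separator e).eq_empty_or_nonempty with h | ⟨v, hv⟩
  · refine Set.finite_empty.subset ?_
    rintro ⟨K, L⟩ ⟨hf, hs⟩
    rw [h] at hs
    exact (hf.2.ne_empty hs).elim
  · refine (((family_finite (G := G) v).prod (family_finite v)).image
      fun p => s(p.1, p.2)).subset ?_
    rintro ⟨K, L⟩ ⟨-, hs⟩
    rw [← hs] at hv
    exact ⟨(K, L), hv, rfl⟩

end Cliques

section Exchange

/-! ### Exchanging edges with equal separators -/

open SimpleGraph

/-- With equal separators, the family of a vertex contains both edges or neither: the swap happens
inside its subtree or deletes nothing from it. -/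
theorem exchange_mem_cliqueTrees {T : SimpleGraph (Cliques G)} (hT : T ∈ cliqueTrees G)
    {K L K' L' : Cliques G} (hKL : T.Adj K L) (hS : K'.1 ∩ L'.1 = K.1 ∩ L.1)
    (hsep : ¬ (T.deleteEdges {s(K, L)}).Reachable K' L') :
    T.deleteEdges {s(K, L)} ⊔ edge K' L' ∈ cliqueTrees G := by
  obtain ⟨hle, htree, hfam⟩ := hT
  have hne : K' ≠ L' := by rintro rfl; exact hsep (Reachable.refl _)
  have hadj : (T.deleteEdges {s(K, L)} ⊔ edge K' L').Adj K' L' :=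
    Or.inr ((edge_adj ..).2 ⟨Or.inl ⟨rfl, rfl⟩, hne⟩)
  have hac : (T.deleteEdges {s(K, L)} ⊔ edge K' L').IsAcyclic :=
    (htree.isAcyclic.anti (deleteEdges_le _)).sup_edge_of_not_reachable hsep
  refine ⟨sup_le ((deleteEdges_le _).trans hle) ?_, ⟨?_, hac⟩, fun v => ?_⟩
  · refine (edge_le_iff ..).2 (Or.inr ⟨hne, ?_⟩)
    rw [hS]
    exact (hle hKL).2
  · have := htree.connected.nonempty
    exact ⟨preconnected_of_exchange htree.connected.preconnected le_sup_left hadj hsep⟩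
  · have := (hfam v).connected.nonempty
    refine ⟨⟨?_⟩, hac.induce _⟩
    have hpre := (hfam v).connected.preconnected
    by_cases hv : v ∈ K.1 ∩ L.1
    · have hv' := hv
      rw [← hS] at hv'
      refine preconnected_of_exchange (a := ⟨K, hv.1⟩) (b := ⟨L, hv.2⟩) (c := ⟨K', hv'.1⟩)
        (d := ⟨L', hv'.2⟩) hpre ?_ hadj ?_
      · rintro ⟨x, hx⟩ ⟨y, hy⟩ h
        rw [deleteEdges_adj] at h
        refine Or.inl ?_
        rw [deleteEdges_adj]
        refine ⟨h.1, fun he => h.2 ?_⟩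
        simpa [Sym2.eq_iff, Subtype.ext_iff] using he
      · intro h
        refine hsep (h.map (⟨Subtype.val, ?_⟩ :
          ((T.induce (family G v)).deleteEdges {s(⟨K, hv.1⟩, ⟨L, hv.2⟩)}) →g _))
        rintro ⟨x, hx⟩ ⟨y, hy⟩ h
        rw [deleteEdges_adj] at h ⊢
        refine ⟨h.1, fun he => h.2 ?_⟩
        simpa [Sym2.eq_iff, Subtype.ext_iff] using he
    · refine hpre.mono ?_
      rintro ⟨x, hx⟩ ⟨y, hy⟩ h
      refine Or.inl ?_
      rw [deleteEdges_adj]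
      refine ⟨h, fun he => hv ?_⟩
      rcases Sym2.eq_iff.1 he with ⟨rfl, rfl⟩ | ⟨rfl, rfl⟩
      · exact ⟨hx, hy⟩
      · exact ⟨hy, hx⟩

/-- The path of `T'` from `K` to `L` crosses the cut that deleting `s(K, L)` makes in `T`. Subtrees
of `T` crossing this cut contain `K` and `L`; subtrees of `T'` containing `K` and `L` contain the
whole path. Hence the separators agree. -/
theorem exists_exchange {T T' : SimpleGraph (Cliques G)} (hT : T ∈ cliqueTrees G)
    (hT' : T' ∈ cliqueTrees G) {K L : Cliques G} (hKL : T.Adj K L) (hKL' : ¬ T'.Adj K L) :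
    ∃ K' L', T'.Adj K' L' ∧ ¬ T.Adj K' L' ∧ K'.1 ∩ L'.1 = K.1 ∩ L.1 ∧
      ¬ (T.deleteEdges {s(K, L)}).Reachable K' L' := by
  obtain ⟨p, hp⟩ := (hT'.2.1.connected.preconnected K L).exists_isPath
  have hbr : ¬ (T.deleteEdges {s(K, L)}).Reachable K L :=
    isAcyclic_iff_forall_isBridge.1 hT.2.1.isAcyclic (e := s(K, L)) hKL
  obtain ⟨⟨⟨K', L'⟩, hadj⟩, hd, hK, hL⟩ := p.exists_boundary_dart
    {M | (T.deleteEdges {s(K, L)}).Reachable K M} (Reachable.refl _) hbr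
  have hsep : ¬ (T.deleteEdges {s(K, L)}).Reachable K' L' := fun h => hL (hK.trans h)
  refine ⟨K', L', hadj, fun h => hsep ?_, ?_, hsep⟩
  · refine Adj.reachable ?_
    rw [deleteEdges_adj]
    refine ⟨h, fun he => hKL' ?_⟩
    have : s(K', L') = s(K, L) := he
    rw [← mem_edgeSet, ← this]
    exact hadj
  · refine Set.Subset.antisymm (fun v hv => ?_) fun v hv => ?_
    · exact mem_of_not_reachable_deleteEdges (hT.2.2 v).connected.preconnected hv.1 hv.2 hsep
    · have := support_subset_of_induce_preconnected hT'.2.1.isAcyclic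
        (hT'.2.2 v).connected.preconnected hv.1 hv.2 ⟨p, hp⟩
      exact ⟨this _ (p.dart_fst_mem_support_of_mem_darts hd),
        this _ (p.dart_snd_mem_support_of_mem_darts hd)⟩

/-- The edges of `T` that some other clique tree avoids. -/
def exchangeable (T : SimpleGraph (Cliques G)) : Set (Sym2 (Cliques G)) :=
  {e | e ∈ T.edgeSet ∧ ∃ T' ∈ cliqueTrees G, e ∉ T'.edgeSet}

theorem finite_of_finite_exchangeable [G.LocallyFinite] {T : SimpleGraph (Cliques G)}
    (hT : T ∈ cliqueTrees G) (hE : (exchangeable T).Finite) : (cliqueTrees G).Finite := by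
  -- An edge of `T'` outside `T` shares its separator with an exchangeable edge of `T`, so all
  -- clique trees agree off the finite set `F`.
  set F : Set (Sym2 (Cliques G)) := exchangeable T ∪
    ⋃ e ∈ exchangeable T, {f | f ∈ (cliqueGraph G).edgeSet ∧ separator f = separator e} with hF
  have hFfin : F.Finite := hE.union (hE.biUnion fun e _ => finite_separator_eq e)
  have hout : ∀ T' ∈ cliqueTrees G, ∀ e ∉ F, e ∈ T'.edgeSet ↔ e ∈ T.edgeSet := by
    intro T' hT' e he
    constructor
    · intro h
      by_contra h'
      induction e with
      | h K' L' =>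
      obtain ⟨K, L, h1, h2, h3, -⟩ := exists_exchange hT' hT h h'
      exact he (Or.inr (Set.mem_biUnion (x := s(K, L)) ⟨h1, T', hT', h2⟩
        ⟨hT'.1 h, h3.symm⟩))
    · intro h
      by_contra h'
      exact he (Or.inl ⟨h, T', hT', h'⟩)
  refine Set.Finite.of_finite_image (f := fun T' : SimpleGraph (Cliques G) => T'.edgeSet ∩ F)
    (hFfin.finite_subsets.subset ?_) ?_
  · rintro _ ⟨T', -, rfl⟩
    exact Set.inter_subset_right
  · intro T₁ h₁ T₂ h₂ h
    refine edgeSet_injective (Set.ext fun e => ?_)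
    by_cases he : e ∈ F
    · have := Set.ext_iff.1 h e
      simpa [he] using this
    · rw [hout T₁ h₁ e he, hout T₂ h₂ e he]

theorem exists_ne_agree_on_finset [G.LocallyFinite] (hinf : (cliqueTrees G).Infinite)
    {T : SimpleGraph (Cliques G)} (hT : T ∈ cliqueTrees G) (D : Finset (Sym2 (Cliques G))) :
    ∃ T' ∈ cliqueTrees G, T' ≠ T ∧ ∀ e ∈ D, e ∈ T'.edgeSet ↔ e ∈ T.edgeSet := by
  have hE : (exchangeable T).Infinite := fun h => hinf (finite_of_finite_exchangeable hT h)
  -- Only finitely many edges share a separator with a member of `D`; swapping any other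
  -- exchangeable edge leaves `D` untouched.
  obtain ⟨e, ⟨heT, T', hT', heT'⟩, he⟩ := (hE.sdiff (D.finite_toSet.biUnion fun e _ =>
    finite_separator_eq (G := G) e)).nonempty
  induction e with
  | h K L =>
  obtain ⟨K', L', h1, h2, h3, h4⟩ := exists_exchange hT hT' heT heT'
  have hD : ∀ e ∈ D, e ≠ s(K, L) ∧ e ≠ s(K', L') := by
    refine fun e heD => ⟨?_, ?_⟩ <;> rintro rfl <;>
      exact he (Set.mem_biUnion heD ⟨hT.1 heT, by simp [h3]⟩)
  refine ⟨_, exchange_mem_cliqueTrees hT heT h3 h4, ?_, fun e heD => ?_⟩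
  · intro h
    refine h2 ?_
    rw [← h]
    exact Or.inr ((edge_adj ..).2 ⟨Or.inl ⟨rfl, rfl⟩, h1.ne⟩)
  · obtain ⟨hd1, hd2⟩ := hD e heD
    rw [edgeSet_sup, edgeSet_deleteEdges, edgeSet_edge]
    simp [hd1, hd2]

end Exchange

section Topology

/-! ### Clique trees as a subset of Cantor space -/

open SimpleGraph Topology

/-- The indicator function of the edge set of a graph. -/
noncomputable def edgeCode {C : Type*} (T : SimpleGraph C) : Sym2 C → Bool :=
  open scoped Classical in fun e => decide (e ∈ T.edgeSet)

@[simp] theorem edgeCode_eq_true {C : Type*} {T : SimpleGraph C} {e : Sym2 C} :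
    edgeCode T e = true ↔ e ∈ T.edgeSet := by simp [edgeCode]

theorem edgeCode_injective {C : Type*} : Function.Injective (edgeCode (C := C)) := by
  intro S T h
  refine edgeSet_injective (Set.ext fun e => ?_)
  rw [← edgeCode_eq_true, h, edgeCode_eq_true]

theorem isClosed_setOf_le {C : Type*} (H : SimpleGraph C) :
    IsClosed {g : Sym2 C → Bool | ∀ e, g e = true → e ∈ H.edgeSet} := by
  simp only [Set.ofPred_forall]
  exact isClosed_iInter fun e =>
    (isClosed_discrete {b : Bool | b = true → e ∈ H.edgeSet}).preimage
      (continuous_apply (A := fun _ => Bool) e)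

/-- A cycle has finitely many edges, so it persists in a neighbourhood. -/
theorem isClosed_setOf_isAcyclic {C : Type*} :
    IsClosed {g : Sym2 C → Bool | (fromEdgeSet {e | g e = true}).IsAcyclic} := by
  rw [← isOpen_compl_iff, isOpen_iff_mem_nhds]
  intro g hg
  simp only [Set.mem_compl_iff, Set.mem_ofPred_eq, IsAcyclic, not_forall, not_not] at hg
  obtain ⟨v, c, hc⟩ := hg
  have hopen : IsOpen (⋂ e ∈ {e | e ∈ c.edges}, {h : Sym2 C → Bool | h e = true}) :=
    (List.finite_toSet c.edges).isOpen_biInter fun e _ =>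
      (isOpen_discrete {b : Bool | b = true}).preimage
        (continuous_apply (A := fun _ => Bool) e)
  have hedge : ∀ e ∈ c.edges, g e = true ∧ ¬ e.IsDiag := fun e he => by
    simpa using c.edges_subset_edgeSet he
  refine Filter.mem_of_superset (hopen.mem_nhds ?_) ?_
  · exact Set.mem_iInter₂.2 fun e he => (hedge e he).1
  · intro h hh hac
    refine hac (c.transfer _ fun e he => ?_) (hc.transfer _)
    have := Set.mem_iInter₂.1 hh e he
    simpa using ⟨this, (hedge e he).2⟩

theorem isClosed_setOf_induce_preconnected {C : Type*} {s : Set C} (hs : s.Finite) :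
    IsClosed {g : Sym2 C → Bool |
      ((fromEdgeSet {e | g e = true}).induce s).Preconnected} := by
  have := hs.to_subtype
  let r : (Sym2 C → Bool) → (Sym2 s → Bool) := fun g e => g (e.map Subtype.val)
  have hr : Continuous r := continuous_pi fun e => continuous_apply _
  convert! (isClosed_discrete {h : Sym2 s → Bool |
    (fromEdgeSet {e | h e = true}).Preconnected}).preimage hr using 1
  ext g
  have : (fromEdgeSet {e | g e = true}).induce s = fromEdgeSet {e | r g e = true} := by
    ext x y
    simp [r, Subtype.ext_iff]
  simp only [Set.mem_ofPred_eq, Set.mem_preimage, this]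

theorem isClosed_image_edgeCode [G.LocallyFinite] :
    IsClosed (edgeCode '' cliqueTrees G) := by
  rcases (cliqueTrees G).eq_empty_or_nonempty with h | ⟨T₀, h₀⟩
  · rw [h, Set.image_empty]; exact isClosed_empty
  have hcl := ((isClosed_setOf_le (cliqueGraph G)).inter isClosed_setOf_isAcyclic).inter
    (isClosed_iInter fun v => isClosed_setOf_induce_preconnected (family_finite (G := G) v))
  convert! hcl using 1
  ext g
  constructor
  · rintro ⟨T, hT, rfl⟩
    have : fromEdgeSet {e | edgeCode T e = true} = T := by simp
    refine ⟨⟨fun e he => ?_, ?_⟩, Set.mem_iInter.2 fun v => ?_⟩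
    · exact edgeSet_mono hT.1 (edgeCode_eq_true.1 he)
    · rw [Set.mem_ofPred_eq, this]; exact hT.2.1.isAcyclic
    · rw [Set.mem_ofPred_eq, this]; exact (hT.2.2 v).connected.preconnected
  · rintro ⟨⟨hle, hac⟩, hfam⟩
    rw [Set.mem_iInter] at hfam
    have hle' : fromEdgeSet {e | g e = true} ≤ cliqueGraph G := by
      intro K L h
      exact hle _ ((fromEdgeSet_adj _).1 h).1
    have := h₀.2.1.connected.nonempty
    refine ⟨fromEdgeSet {e | g e = true}, ⟨hle', ⟨⟨fun K L => ?_⟩, hac⟩, fun v => ?_⟩, ?_⟩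
    -- Connectedness is not a closed condition in general; here the families give it, since the ends
    -- of each edge of `T₀` lie in a common family.
    · obtain ⟨p⟩ := h₀.2.1.connected.preconnected K L
      induction p with
      | nil => exact Reachable.refl _
      | @cons K M _ h p ih =>
        obtain ⟨v, hK, hM⟩ := (h₀.1 h).2
        exact ((hfam v ⟨K, hK⟩ ⟨M, hM⟩).map (Embedding.induce _).toHom).trans ih
    · have := (h₀.2.2 v).connected.nonempty
      exact ⟨⟨hfam v⟩, IsAcyclic.induce hac _⟩
    · ext e
      rw [Bool.eq_iff_iff, edgeCode_eq_true, edgeSet_fromEdgeSet]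
      refine ⟨fun h => h.1, fun h => ⟨h, ?_⟩⟩
      exact (cliqueGraph G).not_isDiag_of_mem_edgeSet (hle e h)

theorem preperfect_image_edgeCode [G.LocallyFinite] (hinf : (cliqueTrees G).Infinite) :
    Preperfect (edgeCode '' cliqueTrees G) := by
  rintro _ ⟨T, hT, rfl⟩
  rw [accPt_iff_nhds]
  intro U hU
  obtain ⟨W, hWU, hW, hTW⟩ := mem_nhds_iff.1 hU
  obtain ⟨D, u, hu, hsub⟩ := isOpen_pi_iff.1 hW _ hTW
  obtain ⟨T', hT', hne, hD⟩ := exists_ne_agree_on_finset hinf hT D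
  refine ⟨edgeCode T', ⟨hWU (hsub fun e he => ?_), T', hT', rfl⟩, edgeCode_injective.ne hne⟩
  have : edgeCode T' e = edgeCode T e := by
    rw [Bool.eq_iff_iff, edgeCode_eq_true, edgeCode_eq_true]
    exact hD e he
  rw [this]
  exact (hu e he).2

end Topology

end CliqueTree

theorem mainTheorem11 {V : Type*} [Infinite V] (G : SimpleGraph V) [G.LocallyFinite]
    (hconn : G.Connected) (hchordal : CliqueTree.IsChordal G) :
    (CliqueTree.cliqueTrees G).Finite ∨
      Cardinal.mk (CliqueTree.cliqueTrees G) = Cardinal.continuum := by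
  rw [or_iff_not_imp_left]
  intro hinf
  have := CliqueTree.countable_cliques hconn
  have : Countable (Sym2 (CliqueTree.Cliques G)) := Quotient.countable
  let := TopologicalSpace.upgradeIsCompletelyMetrizable (Sym2 (CliqueTree.Cliques G) → Bool)
  have hinf : (CliqueTree.cliqueTrees G).Infinite := hinf
  obtain ⟨f, hf, -, hinj⟩ := Perfect.exists_nat_bool_injection
    ⟨CliqueTree.isClosed_image_edgeCode (G := G), CliqueTree.preperfect_image_edgeCode hinf⟩
    (hinf.nonempty.image _)
  rw [← Cardinal.mk_image_eq CliqueTree.edgeCode_injective]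
  apply le_antisymm
  · refine (Cardinal.mk_set_le _).trans ?_
    rw [Cardinal.mk_arrow, Cardinal.mk_bool, Cardinal.lift_two, Cardinal.lift_uzero, ← Cardinal.two_power_aleph0]
    exact Cardinal.power_le_power_left two_ne_zero Cardinal.mk_le_aleph0
  · have h := Cardinal.lift_mk_le_lift_mk_of_injective
      (f := fun x => (⟨f x, hf ⟨x, rfl⟩⟩ : CliqueTree.edgeCode '' CliqueTree.cliqueTrees G))
      fun x y hxy => hinj (congrArg Subtype.val hxy)
    rwa [Cardinal.mk_arrow, Cardinal.mk_bool, Cardinal.mk_nat, Cardinal.lift_aleph0,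
      Cardinal.lift_two, Cardinal.two_power_aleph0, Cardinal.lift_continuum,
      Cardinal.lift_uzero] at h
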